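/- Let $k\ge 0$ be an integer, let $I=[0,1]$, and let $\gamma\colon I\to SO_{2k}$ be a continuous path from $\mathbb 1$ to $-\mathbb 1$. Let $X$ be a topological space (for instance a CW complex) and let $SX$ be its unreduced suspension, the quotient of $X\times I$ by collapsing $X\times\{0\}$ and $X\times\{1\}$ to one point each; write $[x,t]$ for the class of $(x,t)$, let $C_0X$ and $C_1X$ be the cones $\{t\le \frac12\}$ and $\{t\ge\frac12\}$ in $SX$, and identify $x \in X$ with $[x,\frac12]$. For spaces $Y,Z$ let $[Y,Z]$ be the set of free homotopy classes of continuous maps $Y\to Z$; if $Z$ is a topological group, $[Y,Z]$ is a group under pointwise multiplication, whose neutral element, written $0$, is the class of the constant map at the identity. Then $$\mathrm{TO}_\gamma\colon [X,SO_{2k}]\to[SX,SO_{2k}],\qquad [g]\mapsto\bigl[[x,t]\mapsto g(x)\gamma(t)g(x)^{-1}\bigr]$$ is a well-defined map. A continuous map $g\colon X\to SO_{2k}$ is a clutching function of an oriented Euclidean rank-$2k$ vector bundle $E\to SX$ if there are orientation-preserving isometric trivialisations $\varphi_i\colon C_iX\times\mathbb R^{2k}\to E|_{C_iX}$ ($i=0,1$)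 with $\varphi_0^{-1}\varphi_1(x,v)=(x,g(x)v)$ for all $x\in X$, $v\in\mathbb R^{2k}$. The bundle $E$ is $\gamma$-turnable if there is a continuous path $\psi_t$ ($t\in I$) of bundle automorphisms of $E$ (fibrewise linear isometries covering the identity of $SX$, with $(t,v)\mapsto\psi_t(v)$ continuous on $I\times E$) from $\mathbb 1_E$ to $-\mathbb 1_E$ whose restriction to each fibre $E_b$ corresponds, under an orientation-preserving isometry $\mathbb R^{2k}\cong E_b$, to a path in $SO_{2k}$ that is path homotopic (relative to the end points) to $\gamma$. (1) Let $E\to SX$ be an oriented Euclidean rank-$2k$ vector bundle with clutching function $g\colon X\to SO_{2k}$. Then $E$ is $\gamma$-turnable if and only if $\mathrm{TO}_\gamma([g])=0$ in $[SX,SO_{2k}]$. (2) If $X$ is itself (homeomorphic to) a suspension $SY$, then the groups $[X,SO_{2k}]$ and $[SX,SO_{2k}]$ are abelian and $\mathrm{TO}_\gamma$ is a group homomorphism. -/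

import Mathlib

open Set Topology unitInterval Bundle

namespace Turning

universe u v

/-! ### Suspensions -/

/-- The equivalence relation on `X × [0,1]` which collapses `X × {0}` to one point and
`X × {1}` to another one. -/
def suspensionSetoid (X : Type u) : Setoid (X × I) where
  r p q := p = q ∨ (p.2 = 0 ∧ q.2 = 0) ∨ (p.2 = 1 ∧ q.2 = 1)
  iseqv :=
    { refl := fun _ => Or.inl rfl
      symm := by
        rintro p q (h | ⟨h, h'⟩ | ⟨h, h'⟩)
        · exact Or.inl h.symm
        · exact Or.inr (Or.inl ⟨h', h⟩)
        · exact Or.inr (Or.inr ⟨h', h⟩)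
      trans := by
        rintro p q r (rfl | ⟨h, h'⟩ | ⟨h, h'⟩) (rfl | ⟨k, k'⟩ | ⟨k, k'⟩)
        · exact Or.inl rfl
        · exact Or.inr (Or.inl ⟨k, k'⟩)
        · exact Or.inr (Or.inr ⟨k, k'⟩)
        · exact Or.inr (Or.inl ⟨h, h'⟩)
        · exact Or.inr (Or.inl ⟨h, k'⟩)
        · exact absurd (h'.symm.trans k) zero_ne_one
        · exact Or.inr (Or.inr ⟨h, h'⟩)
        · exact absurd (k.symm.trans h') zero_ne_one
        · exact Or.inr (Or.inr ⟨h, k'⟩) }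

/-- The (unreduced) suspension `SX`, with the quotient topology. -/
def Suspension (X : Type u) : Type u := Quotient (suspensionSetoid X)

namespace Suspension

variable {X : Type u}

/-- The point `[x, t]` of `SX`. -/
def mk (x : X) (t : I) : Suspension X := Quotient.mk (suspensionSetoid X) (x, t)

instance [TopologicalSpace X] : TopologicalSpace (Suspension X) :=
  inferInstanceAs (TopologicalSpace (Quotient (suspensionSetoid X)))

/-- The parameter `1/2`, at which `X` sits in `SX`. -/
noncomputable def half : I := ⟨1 / 2, by norm_num, by norm_num⟩

variable (X) in
/-- The cone `C₀X`: the half `t ≤ 1/2` of `SX`. -/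
def cone₀ : Set (Suspension X) := {p | ∃ x t, t ≤ half ∧ p = mk x t}

variable (X) in
/-- The cone `C₁X`: the half `1/2 ≤ t` of `SX`. -/
def cone₁ : Set (Suspension X) := {p | ∃ x t, half ≤ t ∧ p = mk x t}

/-- The inclusion of `X` as the intersection of the two cones. -/
noncomputable def equator (x : X) : Suspension X := mk x half

theorem equator_mem_cone₀ (x : X) : equator x ∈ cone₀ X := ⟨x, half, le_rfl, rfl⟩

theorem equator_mem_cone₁ (x : X) : equator x ∈ cone₁ X := ⟨x, half, le_rfl, rfl⟩

/-- A continuous map on `X × [0,1]` which is constant on `X × {0}` and on `X × {1}` induces a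
continuous map on `SX`. -/
def lift [TopologicalSpace X] {Y : Type v} [TopologicalSpace Y] (f : C(X × I, Y))
    (h₀ : ∀ x x', f (x, 0) = f (x', 0)) (h₁ : ∀ x x', f (x, 1) = f (x', 1)) :
    C(Suspension X, Y) where
  toFun := Quotient.lift (s := suspensionSetoid X) f (by
    rintro ⟨x, t⟩ ⟨x', t'⟩ (h | ⟨h, h'⟩ | ⟨h, h'⟩)
    · rw [h]
    · dsimp only at h h'
      subst h h'
      exact h₀ x x'
    · dsimp only at h h'
      subst h h'
      exact h₁ x x')
  continuous_toFun := Continuous.quotient_lift f.continuous _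

end Suspension

/-! ### Homotopy classes of maps -/

/-- The relation of (free) homotopy on continuous maps. -/
def homotopicSetoid (X : Type u) (Y : Type v) [TopologicalSpace X] [TopologicalSpace Y] :
    Setoid C(X, Y) := ⟨ContinuousMap.Homotopic, ContinuousMap.Homotopic.equivalence⟩

/-- The set `[X, Y]` of (free) homotopy classes of continuous maps. -/
def HomotopyClasses (X : Type u) (Y : Type v) [TopologicalSpace X] [TopologicalSpace Y] :
    Type (max u v) := Quotient (homotopicSetoid X Y)

/-- The homotopy class `[f]`. -/
def HomotopyClasses.mk {X : Type u} {Y : Type v} [TopologicalSpace X] [TopologicalSpace Y]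
    (f : C(X, Y)) : HomotopyClasses X Y := Quotient.mk (homotopicSetoid X Y) f

/-- For a topological group `G`, the set `[X, G]` is a group under pointwise multiplication of
maps; its neutral element is the class of the constant map with value `1`. -/
instance (X : Type u) (G : Type v) [TopologicalSpace X] [TopologicalSpace G] [Group G]
    [IsTopologicalGroup G] : Group (HomotopyClasses X G) where
  mul := Quotient.map₂ (sa := homotopicSetoid X G) (sb := homotopicSetoid X G)
    (sc := homotopicSetoid X G) (fun f g => f * g) (by
      rintro f f' ⟨H⟩ g g' ⟨K⟩
      exact ⟨{ toContinuousMap := H.toContinuousMap * K.toContinuousMap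
               map_zero_left := fun x => by simp
               map_one_left := fun x => by simp }⟩)
  one := HomotopyClasses.mk 1
  inv := Quotient.map (sa := homotopicSetoid X G) (sb := homotopicSetoid X G)
    (fun f => f⁻¹) (by
      rintro f f' ⟨H⟩
      exact ⟨{ toContinuousMap := H.toContinuousMap⁻¹
               map_zero_left := fun x => by simp
               map_one_left := fun x => by simp }⟩)
  mul_assoc := by
    rintro ⟨a⟩ ⟨b⟩ ⟨c⟩
    exact congrArg HomotopyClasses.mk (mul_assoc a b c)
  one_mul := by
    rintro ⟨a⟩
    exact congrArg HomotopyClasses.mk (one_mul a)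
  mul_one := by
    rintro ⟨a⟩
    exact congrArg HomotopyClasses.mk (mul_one a)
  inv_mul_cancel := by
    rintro ⟨a⟩
    exact congrArg HomotopyClasses.mk (inv_mul_cancel a)

/-! ### The special orthogonal group and the turning obstruction -/

/-- The special orthogonal group `SO_n`, with the topology of a subspace of the matrices. -/
abbrev SO (n : ℕ) : Type := Matrix.specialOrthogonalGroup (Fin n) ℝ

instance (n : ℕ) : IsTopologicalGroup (SO n) where
  continuous_mul := by
    refine Continuous.subtype_mk ?_ _
    exact (continuous_subtype_val.comp continuous_fst).mul
      (continuous_subtype_val.comp continuous_snd)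
  continuous_inv := by
    refine Continuous.subtype_mk (f := fun A : SO n => (A : Matrix (Fin n) (Fin n) ℝ).transpose)
      ?_ _
    exact continuous_subtype_val.matrix_transpose

/-- The element `-1` of `SO_{2k}`. -/
def negOne (k : ℕ) : SO (2 * k) :=
  ⟨-1, by
    rw [Matrix.mem_specialOrthogonalGroup_iff, Matrix.mem_orthogonalGroup_iff]
    refine ⟨by simp, ?_⟩
    rw [Matrix.det_neg]
    simp⟩

theorem negOne_central (k : ℕ) (A : SO (2 * k)) : A * negOne k * A⁻¹ = negOne k := by
  rw [mul_inv_eq_iff_eq_mul]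
  apply Subtype.ext
  simp [negOne]

/-- A turning of `ℝ^{2k}`: a path in `SO_{2k}` from `1` to `-1`. -/
abbrev PathTurning (k : ℕ) : Type := Path (1 : SO (2 * k)) (negOne k)

section Obstruction

variable {k : ℕ} {X : Type u} [TopologicalSpace X]

/-- The map `SX → SO_{2k}`, `[x, t] ↦ g(x) γ(t) g(x)⁻¹`. -/
def conjMap (γ : PathTurning k) (g : C(X, SO (2 * k))) : C(Suspension X, SO (2 * k)) :=
  Suspension.lift ⟨fun p : X × I => g p.1 * γ p.2 * (g p.1)⁻¹, by fun_prop⟩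
    (fun x x' => by simp) (fun x x' => by simp [negOne_central])

theorem conjMap_mk (γ : PathTurning k) (g : C(X, SO (2 * k))) (x : X) (t : I) :
    conjMap γ g (Suspension.mk x t) = g x * γ t * (g x)⁻¹ := rfl

theorem conjMap_homotopic (γ : PathTurning k) {g g' : C(X, SO (2 * k))}
    (h : g.Homotopic g') : (conjMap γ g).Homotopic (conjMap γ g') := by
  obtain ⟨H⟩ := h
  let f : C((X × I) × I, SO (2 * k)) :=
    ⟨fun p => H (p.2, p.1.1) * γ p.1.2 * (H (p.2, p.1.1))⁻¹, by fun_prop⟩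
  let F : C(Suspension X, C(I, SO (2 * k))) := Suspension.lift f.curry
    (fun x x' => by ext1 s; simp [f]) (fun x x' => by ext1 s; simp [f, negOne_central])
  refine ⟨{ toFun := fun p => F p.2 p.1, continuous_toFun := ?_, map_zero_left := ?_,
            map_one_left := ?_ }⟩
  · exact (ContinuousMap.continuous_uncurry_of_continuous F).comp continuous_swap
  · rintro ⟨x, t⟩
    change H (0, x) * γ t * (H (0, x))⁻¹ = g x * γ t * (g x)⁻¹
    simp
  · rintro ⟨x, t⟩
    change H (1, x) * γ t * (H (1, x))⁻¹ = g' x * γ t * (g' x)⁻¹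
    simp

/-- The (adjointed) `γ`-turning obstruction map
`TO_γ : [X, SO_{2k}] → [SX, SO_{2k}]`, `[g] ↦ [[x, t] ↦ g(x) γ(t) g(x)⁻¹]`. -/
def TO (γ : PathTurning k) (X : Type u) [TopologicalSpace X] :
    HomotopyClasses X (SO (2 * k)) → HomotopyClasses (Suspension X) (SO (2 * k)) :=
  Quotient.map (sa := homotopicSetoid _ _) (sb := homotopicSetoid _ _) (conjMap γ)
    (fun _ _ h => conjMap_homotopic γ h)

end Obstruction

/-! ### Oriented Euclidean vector bundles -/

/-- Euclidean space `ℝ^n`. -/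
abbrev Eu (n : ℕ) : Type := EuclideanSpace ℝ (Fin n)

/-- The standard orientation of `ℝ^n`. -/
noncomputable def stdOrientation (n : ℕ) : Orientation ℝ (Eu n) (Fin n) :=
  (EuclideanSpace.basisFun (Fin n) ℝ).toBasis.orientation

section Bundles

variable {n : ℕ} {B : Type u} [TopologicalSpace B] (E : B → Type v)
  [TopologicalSpace (TotalSpace (Eu n) E)] [∀ b, NormedAddCommGroup (E b)]
  [∀ b, InnerProductSpace ℝ (E b)]

/-- An orientation of a rank-`n` vector bundle: an orientation of each fibre which, read in local
trivialisations of the bundle, is locally constant. -/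
structure BundleOrientation [FiberBundle (Eu n) E] [VectorBundle ℝ (Eu n) E] where
  /-- The orientation of the fibre over `b`. -/
  fibre : ∀ b, Orientation ℝ (E b) (Fin n)
  locally_constant : ∀ b₀, ∃ U ∈ 𝓝 b₀, ∃ hU : U ⊆ (trivializationAt (Eu n) E b₀).baseSet,
    ∃ o : Orientation ℝ (Eu n) (Fin n), ∀ b (hb : b ∈ U),
      Orientation.map (Fin n)
        ((trivializationAt (Eu n) E b₀).linearEquivAt ℝ b (hU hb)) (fibre b) = o

variable {E}

/-- A linear isometry `ℝ^n ≃ E_b` which carries the standard orientation to the orientation `o`. -/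
def IsOrientedFrame {b : B} (o : Orientation ℝ (E b) (Fin n)) (φ : Eu n ≃ₗᵢ[ℝ] E b) : Prop :=
  Orientation.map (Fin n) φ.toLinearEquiv (stdOrientation n) = o

variable [FiberBundle (Eu n) E] [VectorBundle ℝ (Eu n) E]

/-- A trivialisation `C × ℝ^n → E|_C` over a subset `C` of the base, by fibrewise linear isometries
which preserve the orientations. (The bijection `C × ℝ^n → E|_C` is then automatically a
homeomorphism, since the inner product of `E` is continuous.) -/
structure TrivialisationOver (o : BundleOrientation (n := n) E) (C : Set B) where
  /-- The isometry between `ℝ^n` and the fibre over `b`. -/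
  frame : ∀ b : C, Eu n ≃ₗᵢ[ℝ] E b
  oriented : ∀ b : C, IsOrientedFrame (o.fibre b) (frame b)
  continuous_frame : Continuous fun p : C × Eu n =>
    (⟨p.1, frame p.1 p.2⟩ : TotalSpace (Eu n) E)

variable (n E) in
/-- A turning of a Euclidean bundle `E`: a path of bundle automorphisms (fibrewise linear
isometries over the identity of the base) from the identity to minus the identity. -/
structure BundleTurning where
  /-- The automorphism at time `t`, in the fibre over `b`. -/
  aut : I → ∀ b, E b ≃ₗᵢ[ℝ] E b
  continuous_aut : Continuous fun p : I × TotalSpace (Eu n) E =>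
    (⟨p.2.1, aut p.1 p.2.1 p.2.2⟩ : TotalSpace (Eu n) E)
  aut_zero : ∀ b (v : E b), aut 0 b v = v
  aut_one : ∀ b (v : E b), aut 1 b v = -v

end Bundles

section GammaTurnings

variable {k : ℕ} {B : Type u} [TopologicalSpace B] {E : B → Type v}
  [TopologicalSpace (TotalSpace (Eu (2 * k)) E)] [∀ b, NormedAddCommGroup (E b)]
  [∀ b, InnerProductSpace ℝ (E b)] [FiberBundle (Eu (2 * k)) E] [VectorBundle ℝ (Eu (2 * k)) E]

/-- A turning of an oriented bundle is a `γ`-turning if in each fibre `E_b`, under an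
orientation-preserving isometry `ℝ^{2k} ≃ E_b`, it is a path `δ` in `SO_{2k}` from `1` to `-1`
which is path homotopic to `γ`. -/
def BundleTurning.IsGammaTurning (ψ : BundleTurning (2 * k) E)
    (o : BundleOrientation (n := 2 * k) E) (γ : PathTurning k) : Prop :=
  ∀ b, ∃ φ : Eu (2 * k) ≃ₗᵢ[ℝ] E b, IsOrientedFrame (o.fibre b) φ ∧
    ∃ δ : PathTurning k, δ.Homotopic γ ∧
      ∀ (t : I) (v : Eu (2 * k)),
        ψ.aut t b (φ v) =
          φ (Matrix.toEuclideanLin (δ t : Matrix (Fin (2 * k)) (Fin (2 * k)) ℝ) v)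

/-- An oriented bundle is `γ`-turnable if it has a `γ`-turning. -/
def GammaTurnable (o : BundleOrientation (n := 2 * k) E) (γ : PathTurning k) : Prop :=
  ∃ ψ : BundleTurning (2 * k) E, ψ.IsGammaTurning o γ

end GammaTurnings

section Clutching

variable {n : ℕ} {X : Type u} [TopologicalSpace X] {E : Suspension X → Type v}
  [TopologicalSpace (TotalSpace (Eu n) E)] [∀ b, NormedAddCommGroup (E b)]
  [∀ b, InnerProductSpace ℝ (E b)] [FiberBundle (Eu n) E] [VectorBundle ℝ (Eu n) E]

/-- The map `g : X → SO_n` is a clutching function of the oriented bundle `E` over `SX`: there are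
trivialisations `φ₀`, `φ₁` of `E` over the two cones such that `φ₀⁻¹ φ₁ (x, v) = (x, g(x) v)` for
all `x` in `X`. -/
def IsClutchingFunction (o : BundleOrientation (n := n) E) (g : C(X, SO n)) : Prop :=
  ∃ (φ₀ : TrivialisationOver o (Suspension.cone₀ X))
    (φ₁ : TrivialisationOver o (Suspension.cone₁ X)),
    ∀ (x : X) (v : Eu n),
      (φ₀.frame ⟨Suspension.equator x, Suspension.equator_mem_cone₀ x⟩).symm
        (φ₁.frame ⟨Suspension.equator x, Suspension.equator_mem_cone₁ x⟩ v) =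
        Matrix.toEuclideanLin (g x : Matrix (Fin n) (Fin n) ℝ) v

end Clutching

end Turning

namespace Turning

universe u v w

/-! For (1), a turning read in trivialisations over the cones is a pair of continuous families of
paths from `1` to `-1` in `SO_{2k}`, one over each cone, conjugate by `g` over the equator. Suppose
the bundle is `γ`-turnable. Contracting `C₁X` to its tip deforms the family there to one fixed path,
a conjugate `h δ h⁻¹` with `δ` path homotopic to `γ`; since `SO_{2k}` is path connected, `h` can be
absorbed into `g`. So `g γ g⁻¹` is homotopic to the equatorial family of the trivialisation over
`C₀X`. Contracting `C₀X` to its tip makes that family independent of `x`, and a map on `SX` that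
depends only on `t` is null-homotopic.

Conversely, a free null-homotopy of `g γ g⁻¹` can be corrected by pointwise multiplication so that
every stage consists of paths from `1` to `-1` and the last stage is independent of `x`. It then
extends `g γ g⁻¹` from the equator over `C₀X`, and glues to the constant family `γ` over `C₁X`
(`exists_rel_nullhomotopy`, `exists_bundleTurning_of_cones`).

For (2), two maps from a suspension to a path connected group can be deformed so that at each point
one of them is `1` (`exists_homotopic_disjoint_support`). Such maps commute pointwise, and after
division by the null-homotopic map `[x, t] ↦ γ(t)` the conjugation map is multiplicative on them. -/

theorem toEuclideanLin_mul_apply {n : ℕ} (A B : Matrix (Fin n) (Fin n) ℝ) (v : Eu n) :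
    Matrix.toEuclideanLin (A * B) v = Matrix.toEuclideanLin A (Matrix.toEuclideanLin B v) := by
  simp [Matrix.toLpLin_apply]

theorem toEuclideanLin_one_apply {n : ℕ} (v : Eu n) :
    Matrix.toEuclideanLin (1 : Matrix (Fin n) (Fin n) ℝ) v = v := by
  simp

theorem inner_single_toEuclideanLin_single {n : ℕ} (A : Matrix (Fin n) (Fin n) ℝ) (i j : Fin n) :
    inner ℝ (EuclideanSpace.single i (1 : ℝ))
      (Matrix.toEuclideanLin A (EuclideanSpace.single j (1 : ℝ))) = A i j := by
  simp [Matrix.toLpLin_apply, EuclideanSpace.inner_single_left]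

/-! ### Special orthogonal matrices as orientation-preserving isometries. -/

namespace SO

variable {n : ℕ}

theorem mul_transpose (A : SO n) : (A : Matrix (Fin n) (Fin n) ℝ) * (A : Matrix _ _ ℝ).transpose = 1 :=
  (Matrix.mem_orthogonalGroup_iff _ _).1 (Matrix.mem_specialOrthogonalGroup_iff.1 A.2).1

theorem transpose_mul (A : SO n) : (A : Matrix (Fin n) (Fin n) ℝ).transpose * (A : Matrix _ _ ℝ) = 1 :=
  mul_eq_one_comm.1 A.mul_transpose

theorem coe_inv (A : SO n) : ((A⁻¹ : SO n) : Matrix (Fin n) (Fin n) ℝ) =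
    (A : Matrix (Fin n) (Fin n) ℝ).transpose := rfl

theorem det_eq_one (A : SO n) : (A : Matrix (Fin n) (Fin n) ℝ).det = 1 :=
  (Matrix.mem_specialOrthogonalGroup_iff.1 A.2).2

/-- The linear isometry of Euclidean space given by a special orthogonal matrix. -/
noncomputable def toIsometry (A : SO n) : Eu n ≃ₗᵢ[ℝ] Eu n :=
  LinearEquiv.isometryOfInner
    (LinearEquiv.ofLinearMap (Matrix.toEuclideanLin (A : Matrix (Fin n) (Fin n) ℝ))
      (Matrix.toEuclideanLin (A : Matrix (Fin n) (Fin n) ℝ).transpose)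
      (by ext1 v; simp [← toEuclideanLin_mul_apply, mul_transpose])
      (by ext1 v; simp [← toEuclideanLin_mul_apply, transpose_mul]))
    (fun v w => by
      have h := toEuclideanLin_mul_apply (A : Matrix (Fin n) (Fin n) ℝ).transpose A w
      rw [transpose_mul, toEuclideanLin_one_apply] at h
      have h' := Matrix.toEuclideanLin_conjTranspose_eq_adjoint (A : Matrix (Fin n) (Fin n) ℝ)
      rw [Matrix.conjTranspose_eq_transpose_of_trivial] at h'
      rw [h'] at h
      refine Eq.trans ?_ (congrArg (inner ℝ v) h.symm)
      exact (LinearMap.adjoint_inner_right _ _ _).symm)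

theorem toIsometry_apply (A : SO n) (v : Eu n) :
    A.toIsometry v = Matrix.toEuclideanLin (A : Matrix (Fin n) (Fin n) ℝ) v := rfl

theorem toIsometry_mul (A B : SO n) (v : Eu n) :
    (A * B).toIsometry v = A.toIsometry (B.toIsometry v) :=
  toEuclideanLin_mul_apply _ _ _

theorem toIsometry_one (v : Eu n) : (1 : SO n).toIsometry v = v := toEuclideanLin_one_apply v

theorem toIsometry_negOne (k : ℕ) (v : Eu (2 * k)) : (negOne k).toIsometry v = -v := by
  rw [toIsometry_apply]
  simp [negOne]

theorem toIsometry_inv_apply (A : SO n) (v : Eu n) : A.toIsometry ((A⁻¹).toIsometry v) = v := by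
  rw [← toIsometry_mul, mul_inv_cancel, toIsometry_one]

theorem toIsometry_injective {A B : SO n} (h : ∀ v, A.toIsometry v = B.toIsometry v) : A = B := by
  apply Subtype.ext
  apply Matrix.toEuclideanLin.injective
  ext1 v
  exact h v

theorem inner_single_toIsometry_single (A : SO n) (i j : Fin n) :
    inner ℝ (EuclideanSpace.single i (1 : ℝ)) (A.toIsometry (EuclideanSpace.single j (1 : ℝ))) =
      (A : Matrix (Fin n) (Fin n) ℝ) i j :=
  inner_single_toEuclideanLin_single _ i j

theorem continuous_toIsometry_apply :
    Continuous fun p : SO n × Eu n => p.1.toIsometry p.2 := by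
  simp only [toIsometry_apply, Matrix.toLpLin_apply]
  refine (PiLp.continuous_toLp 2 _).comp ?_
  exact (continuous_subtype_val.comp continuous_fst).matrix_mulVec
    ((PiLp.continuous_ofLp 2 _).comp continuous_snd)

theorem continuous_of_apply {Z : Type*} [TopologicalSpace Z] {f : Z → SO n}
    (h : ∀ i j, Continuous fun z => (f z : Matrix (Fin n) (Fin n) ℝ) i j) : Continuous f :=
  Continuous.subtype_mk (f := fun z => (f z : Matrix (Fin n) (Fin n) ℝ))
    (continuous_matrix h) _

theorem det_toIsometry (A : SO n) :
    LinearMap.det (A.toIsometry.toLinearEquiv : Eu n →ₗ[ℝ] Eu n) = 1 := by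
  have : (A.toIsometry.toLinearEquiv : Eu n →ₗ[ℝ] Eu n) =
      Matrix.toEuclideanLin (A : Matrix (Fin n) (Fin n) ℝ) := rfl
  rw [this, Matrix.toEuclideanLin_eq_toLin_orthonormal, LinearMap.det_toLin, det_eq_one]

theorem map_stdOrientation (A : SO n) :
    Orientation.map (Fin n) A.toIsometry.toLinearEquiv (stdOrientation n) = stdOrientation n := by
  rw [Orientation.map_eq_iff_det_pos _ _ (by simp), det_toIsometry]
  exact one_pos

/-- Preservation of inner products gives `Mᵀ M = 1`, hence `det M ^ 2 = 1`; positivity selects the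
root `1`. -/
theorem exists_toIsometry_eq (φ : Eu n ≃ₗᵢ[ℝ] Eu n)
    (h : 0 < LinearMap.det (φ.toLinearEquiv : Eu n →ₗ[ℝ] Eu n)) :
    ∃ A : SO n, ∀ v, A.toIsometry v = φ v := by
  let b := EuclideanSpace.basisFun (Fin n) ℝ
  let M : Matrix (Fin n) (Fin n) ℝ :=
    LinearMap.toMatrix b.toBasis b.toBasis (φ.toLinearEquiv : Eu n →ₗ[ℝ] Eu n)
  have hM : Matrix.toEuclideanLin M = (φ.toLinearEquiv : Eu n →ₗ[ℝ] Eu n) := by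
    rw [Matrix.toEuclideanLin_eq_toLin_orthonormal]
    exact Matrix.toLin_toMatrix _ _ _
  have hMv (v : Eu n) : Matrix.toEuclideanLin M v = φ v := by rw [hM]; rfl
  have hentry : M.transpose * M = (1 : Matrix (Fin n) (Fin n) ℝ) := by
    ext i j
    rw [← inner_single_toEuclideanLin_single (M.transpose * M),
      ← inner_single_toEuclideanLin_single (1 : Matrix (Fin n) (Fin n) ℝ),
      toEuclideanLin_mul_apply, toEuclideanLin_one_apply]
    have h' := Matrix.toEuclideanLin_conjTranspose_eq_adjoint M
    rw [Matrix.conjTranspose_eq_transpose_of_trivial] at h'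
    rw [h', LinearMap.adjoint_inner_right, hMv, hMv, φ.inner_map_map]
  refine ⟨⟨M, ?_⟩, hMv⟩
  rw [Matrix.mem_specialOrthogonalGroup_iff, Matrix.mem_orthogonalGroup_iff']
  refine ⟨hentry, ?_⟩
  have hdet : M.det = LinearMap.det (φ.toLinearEquiv : Eu n →ₗ[ℝ] Eu n) :=
    LinearMap.det_toMatrix _ _
  have hsq := congrArg Matrix.det hentry
  rw [Matrix.det_mul, Matrix.det_transpose, Matrix.det_one] at hsq
  rw [← hdet] at h
  nlinarith

theorem exists_toIsometry_eq_of_map_stdOrientation (φ : Eu n ≃ₗᵢ[ℝ] Eu n)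
    (h : Orientation.map (Fin n) φ.toLinearEquiv (stdOrientation n) = stdOrientation n) :
    ∃ A : SO n, ∀ v, A.toIsometry v = φ v := by
  apply exists_toIsometry_eq
  rwa [Orientation.map_eq_iff_det_pos _ _ (by simp)] at h

/-! ### Path connectedness -/

/-- The matrix of the reflection in the hyperplane orthogonal to `v`. -/
noncomputable def householder (v : Eu n) : Matrix (Fin n) (Fin n) ℝ :=
  1 - (2 / ‖v‖ ^ 2) • Matrix.vecMulVec v.ofLp v.ofLp

theorem toEuclideanLin_householder (v w : Eu n) :
    Matrix.toEuclideanLin (householder v) w = (ℝ ∙ v)ᗮ.reflection w := by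
  rw [Submodule.reflection_orthogonal_apply, Submodule.reflection_singleton_apply,
    Matrix.toLpLin_apply]
  ext i
  simp [householder, Matrix.sub_mulVec, Matrix.smul_mulVec, Matrix.vecMulVec_mulVec,
    PiLp.inner_apply, dotProduct]
  simp only [mul_comm (w.ofLp _)]
  ring

theorem det_householder {v : Eu n} (hv : v ≠ 0) : (householder v).det = -1 := by
  have h : (Matrix.toEuclideanLin (householder v)) =
      ((ℝ ∙ v)ᗮ.reflection.toLinearMap : Eu n →ₗ[ℝ] Eu n) := by
    ext1 w
    exact toEuclideanLin_householder v w
  have h2 := (ℝ ∙ v)ᗮ.det_reflection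
  rw [Submodule.orthogonal_orthogonal, finrank_span_singleton hv, pow_one] at h2
  have h3 := congrArg LinearMap.det h
  rw [Matrix.toEuclideanLin_eq_toLin_orthonormal, LinearMap.det_toLin] at h3
  exact h3.trans h2

theorem householder_mul_self (v : Eu n) : householder v * householder v = 1 := by
  apply Matrix.toEuclideanLin.injective
  ext1 w
  rw [toEuclideanLin_mul_apply, toEuclideanLin_householder, toEuclideanLin_householder,
    toEuclideanLin_one_apply, Submodule.reflection_reflection]

theorem householder_transpose (v : Eu n) : (householder v).transpose = householder v := by
  simp [householder, Matrix.transpose_sub, Matrix.transpose_vecMulVec]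

theorem continuousOn_householder : ContinuousOn (householder (n := n)) {0}ᶜ := by
  unfold householder
  refine continuousOn_const.sub
    (ContinuousOn.fun_smul (f := fun v : Eu n => 2 / ‖v‖ ^ 2) ?_ ?_)
  · refine continuousOn_const.div (by fun_prop) fun v hv => ?_
    simpa using hv
  · exact (Continuous.matrix_vecMulVec (PiLp.continuous_ofLp 2 _)
      (PiLp.continuous_ofLp 2 _)).continuousOn

/-- The product of two reflections. -/
noncomputable def rotor (u v : ({0}ᶜ : Set (Eu n))) : SO n :=
  ⟨householder u.1 * householder v.1, by
    rw [Matrix.mem_specialOrthogonalGroup_iff, Matrix.mem_orthogonalGroup_iff]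
    refine ⟨?_, by rw [Matrix.det_mul, det_householder u.2, det_householder v.2]; norm_num⟩
    rw [Matrix.transpose_mul, householder_transpose, householder_transpose, mul_assoc,
      ← mul_assoc (householder v.1), householder_mul_self, one_mul, householder_mul_self]⟩

/-- Sliding the second vector from `u` to `v` joins `rotor u u = 1` to `rotor u v`. The slide avoids
`0`, which is possible because the punctured space is path connected for `n > 1`. -/
theorem joined_one_rotor (hn : 1 < n) (u v : ({0}ᶜ : Set (Eu n))) : Joined 1 (rotor u v) := by
  have hpc : IsPathConnected ({0}ᶜ : Set (Eu n)) :=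
    isPathConnected_compl_singleton_of_one_lt_rank (by
      rw [← Module.finrank_eq_rank]
      simpa using hn) 0
  have : PathConnectedSpace ({0}ᶜ : Set (Eu n)) := isPathConnected_iff_pathConnectedSpace.1 hpc
  have hc : Continuous fun w : ({0}ᶜ : Set (Eu n)) => rotor u w :=
    Continuous.subtype_mk (continuous_const.mul continuousOn_householder.domRestrict) _
  have h1 : rotor u u = 1 := Subtype.ext (householder_mul_self _)
  rw [← h1]
  exact (PathConnectedSpace.joined u v).map hc

/-- Reflections are split off in pairs, each pair being a rotor joined to `1`. A single leftover
reflection is excluded by its determinant `-1`. -/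
theorem joined_one_of_reflections (hn : 1 < n) : ∀ (m : ℕ) (l : List (Eu n)), l.length ≤ m →
    (∀ v ∈ l, v ≠ 0) → ∀ A : SO n, (A : Matrix (Fin n) (Fin n) ℝ) = (l.map householder).prod →
    Joined 1 A := by
  intro m
  induction m using Nat.strong_induction_on with
  | _ m ih =>
    intro l hl h0 A hA
    match l with
    | [] =>
      have : A = 1 := Subtype.ext (by simpa using hA)
      rw [this]
    | [u] =>
      exfalso
      have h := A.det_eq_one
      rw [hA] at h
      simp only [List.map_cons, List.map_nil, List.prod_cons, List.prod_nil, mul_one] at h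
      rw [det_householder (h0 u (by simp))] at h
      norm_num at h
    | u :: v :: l =>
      let R : SO n := rotor ⟨u, h0 u (by simp)⟩ ⟨v, h0 v (by simp)⟩
      have hR : (R : Matrix (Fin n) (Fin n) ℝ) = householder u * householder v := rfl
      have h' : Joined 1 (R⁻¹ * A) := by
        simp only [List.length_cons] at hl
        refine ih l.length (by omega) l le_rfl (fun w hw => h0 w (by simp [hw])) _ ?_
        have : (R : Matrix (Fin n) (Fin n) ℝ) * (l.map householder).prod = A := by
          rw [hA, hR]; simp [mul_assoc]
        rw [Submonoid.coe_mul, ← this, ← mul_assoc, coe_inv, transpose_mul, one_mul]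
      obtain ⟨p⟩ := joined_one_rotor hn ⟨u, h0 u (by simp)⟩ ⟨v, h0 v (by simp)⟩
      obtain ⟨q⟩ := h'
      have hpq : (1 : SO n) * 1 = 1 := mul_one 1
      have hA' : R * (R⁻¹ * A) = A := mul_inv_cancel_left R A
      exact ⟨(p.mul q).cast hpq.symm hA'.symm⟩

/-- By Cartan–Dieudonné every isometry is a product of reflections. -/
theorem joined_one (hn : n ≠ 1) (A : SO n) : Joined 1 A := by
  rcases Nat.lt_or_ge 1 n with h | h
  · obtain ⟨l, -, hl⟩ := A.toIsometry.reflections_generate_dim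
    classical
    -- A zero vector in the list contributes the identity, so it can be dropped.
    refine joined_one_of_reflections h _ (l.filter (fun v => v ≠ 0)) le_rfl (by simp) A ?_
    apply Matrix.toEuclideanLin.injective
    ext1 v
    rw [← toIsometry_apply, hl]
    clear hl
    induction l generalizing v with
    | nil => simp
    | cons u l ih =>
      rw [List.map_cons, List.prod_cons, LinearIsometryEquiv.coe_mul, Function.comp_apply, ih]
      by_cases hu : u = 0
      · rw [Submodule.reflection_mem_subspace_eq_self (by simp [hu])]
        simp [hu]
      · simp [hu, toEuclideanLin_householder]
  · have hn0 : n = 0 := by omega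
    subst hn0
    have : A = 1 := Subtype.ext (Subsingleton.elim _ _)
    rw [this]

instance (k : ℕ) : PathConnectedSpace (SO (2 * k)) where
  nonempty := ⟨1⟩
  joined A B := (joined_one (by omega) A).symm.trans (joined_one (by omega) B)

end SO

/-! ### Homotopies on suspensions -/

namespace Suspension

variable {X : Type u}

theorem mk_surjective (p : Suspension X) : ∃ x t, p = mk x t := by
  obtain ⟨x, t⟩ := p
  exact ⟨x, t, rfl⟩

theorem mk_zero (x x' : X) : mk x 0 = mk x' 0 := Quotient.sound (Or.inr (Or.inl ⟨rfl, rfl⟩))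

theorem mk_one (x x' : X) : mk x 1 = mk x' 1 := Quotient.sound (Or.inr (Or.inr ⟨rfl, rfl⟩))

variable [TopologicalSpace X] {Z : Type v} [TopologicalSpace Z]

theorem continuous_mk : Continuous fun p : X × I => mk p.1 p.2 :=
  continuous_quotient_mk'

@[fun_prop]
theorem _root_.Continuous.suspension_mk {W : Type w} [TopologicalSpace W] {f : W → X} {t : W → I}
    (hf : Continuous f) (ht : Continuous t) : Continuous fun p => mk (f p) (t p) :=
  continuous_mk.comp (hf.prodMk ht)

theorem lift_mk (f : C(X × I, Z)) (h₀ h₁) (x : X) (t : I) : lift f h₀ h₁ (mk x t) = f (x, t) := rfl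

theorem ext_mk {f f' : C(Suspension X, Z)} (h : ∀ x t, f (mk x t) = f' (mk x t)) : f = f' := by
  ext p
  obtain ⟨x, t, rfl⟩ := mk_surjective p
  exact h x t

/-- A family of continuous maps on `X × [0,1]`, each constant on `X × {0}` and on `X × {1}`, induces
a homotopy on `SX`. -/
theorem homotopic_of_family {f f' : C(Suspension X, Z)} (F : C((X × I) × I, Z))
    (h₀ : ∀ x x' s, F ((x, 0), s) = F ((x', 0), s)) (h₁ : ∀ x x' s, F ((x, 1), s) = F ((x', 1), s))
    (hf : ∀ x t, F ((x, t), 0) = f (mk x t)) (hf' : ∀ x t, F ((x, t), 1) = f' (mk x t)) :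
    f.Homotopic f' := by
  -- After currying, the universal property of the quotient applies to `SX` alone; nothing is needed
  -- about the product of the quotient map with `I`.
  let G : C(Suspension X, C(I, Z)) := lift F.curry
    (fun x x' => by ext1 s; exact h₀ x x' s) (fun x x' => by ext1 s; exact h₁ x x' s)
  refine ⟨{ toFun := fun p => G p.2 p.1, continuous_toFun := ?_, map_zero_left := ?_,
            map_one_left := ?_ }⟩
  · exact (ContinuousMap.continuous_uncurry_of_continuous G).comp continuous_swap
  · rintro ⟨x, t⟩
    exact hf x t
  · rintro ⟨x, t⟩
    exact hf' x t

/-- The level `t` of the point `[x, t]`. -/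
def height : C(Suspension X, I) := lift ⟨Prod.snd, continuous_snd⟩ (fun _ _ => rfl) (fun _ _ => rfl)

theorem mem_cone₀_iff (p : Suspension X) : p ∈ cone₀ X ↔ height p ≤ half := by
  constructor
  · rintro ⟨x, t, ht, rfl⟩
    exact ht
  · obtain ⟨x, t, rfl⟩ := mk_surjective p
    exact fun h => ⟨x, t, h, rfl⟩

theorem mem_cone₁_iff (p : Suspension X) : p ∈ cone₁ X ↔ half ≤ height p := by
  constructor
  · rintro ⟨x, t, ht, rfl⟩
    exact ht
  · obtain ⟨x, t, rfl⟩ := mk_surjective p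
    exact fun h => ⟨x, t, h, rfl⟩

theorem isClosed_cone₀ : IsClosed (cone₀ X) := by
  have : cone₀ X = {p | height p ≤ half} := Set.ext mem_cone₀_iff
  rw [this]
  exact isClosed_le height.continuous continuous_const

theorem isClosed_cone₁ : IsClosed (cone₁ X) := by
  have : cone₁ X = {p | half ≤ height p} := Set.ext mem_cone₁_iff
  rw [this]
  exact isClosed_le continuous_const height.continuous

theorem mem_cone₀_or_mem_cone₁ (p : Suspension X) : p ∈ cone₀ X ∨ p ∈ cone₁ X := by
  rw [mem_cone₀_iff, mem_cone₁_iff]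
  exact le_total _ _

theorem exists_eq_equator {p : Suspension X} (h₀ : p ∈ cone₀ X) (h₁ : p ∈ cone₁ X) :
    ∃ x, p = equator x := by
  rw [mem_cone₀_iff] at h₀
  rw [mem_cone₁_iff] at h₁
  obtain ⟨x, t, rfl⟩ := mk_surjective p
  have : t = half := le_antisymm h₀ h₁
  exact ⟨x, by rw [this]; rfl⟩

/-- Reparametrising the suspension coordinate does not change the homotopy class of a map. -/
theorem homotopic_of_reparam {f f' : C(Suspension X, Z)} (φ : C(I, I)) (φ0 : φ 0 = 0) (φ1 : φ 1 = 1)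
    (h : ∀ x t, f' (mk x t) = f (mk x (φ t))) : f.Homotopic f' := by
  -- The straight-line homotopy from the identity to `φ`; it fixes `0` and `1` throughout, so it
  -- respects both poles.
  let ρ : C(I × I, I) :=
    ⟨fun p => ⟨(1 - p.2) * p.1 + p.2 * φ p.1, by
      obtain ⟨⟨t, ht0, ht1⟩, ⟨s, hs0, hs1⟩⟩ := p
      obtain ⟨a0, a1⟩ := (φ ⟨t, ht0, ht1⟩).2
      constructor
      · have := sub_nonneg.2 hs1
        positivity
      · dsimp only
        nlinarith⟩, by fun_prop⟩
  have ρ0 (s : I) : ρ (0, s) = 0 := Subtype.ext (by simp [ρ, φ0])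
  have ρ1 (s : I) : ρ (1, s) = 1 := Subtype.ext (by simp [ρ, φ1])
  have hρ0 (t : I) : ρ (t, 0) = t := Subtype.ext (by simp [ρ])
  have hρ1 (t : I) : ρ (t, 1) = φ t := Subtype.ext (by simp [ρ])
  refine homotopic_of_family ⟨fun p => f (mk p.1.1 (ρ (p.1.2, p.2))), by fun_prop⟩ ?_ ?_ ?_ ?_
  · intro x x' s
    simp only [ContinuousMap.coe_mk, ρ0, mk_zero x x']
  · intro x x' s
    simp only [ContinuousMap.coe_mk, ρ1, mk_one x x']
  · intro x t
    simp only [ContinuousMap.coe_mk, hρ0]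
  · intro x t
    simp only [ContinuousMap.coe_mk, hρ1, h]

/-- A map from a suspension to a path connected topological group is homotopic to a map which is
trivial wherever the given reparametrisation of the suspension coordinate is constant. -/
theorem exists_homotopic_eq_one {G : Type v} [TopologicalSpace G] [Group G] [IsTopologicalGroup G]
    [PathConnectedSpace G] (f : C(Suspension X, G)) (φ : C(I, I)) (φ0 : φ 0 = 0) (φ1 : φ 1 = 1)
    (c : I) (hc : c = 0 ∨ c = 1) :
    ∃ f' : C(Suspension X, G), f.Homotopic f' ∧ ∀ x t, φ t = c → f' (mk x t) = 1 := by
  rcases isEmpty_or_nonempty X with hX | ⟨⟨x₀⟩⟩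
  · exact ⟨f, .refl f, fun x => hX.elim x⟩
  let f₁ : C(Suspension X, G) := lift ⟨fun p => f (mk p.1 (φ p.2)), by fun_prop⟩
    (fun x x' => by simp only [ContinuousMap.coe_mk, φ0, mk_zero x x'])
    (fun x x' => by simp only [ContinuousMap.coe_mk, φ1, mk_one x x'])
  have h₁ : f.Homotopic f₁ := homotopic_of_reparam φ φ0 φ1 (fun x t => rfl)
  -- Where `φ` equals `c`, the reparametrised map takes the single value `a` of `f` at a pole. Left
  -- translation along a path from `1` to `a⁻¹` moves this value to `1`.
  let a : G := f (mk x₀ c)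
  obtain ⟨p⟩ := PathConnectedSpace.joined (1 : G) a⁻¹
  refine ⟨⟨fun q => a⁻¹ * f₁ q, by fun_prop⟩, h₁.trans ⟨{
    toFun := fun q => p q.1 * f₁ q.2
    continuous_toFun := by fun_prop
    map_zero_left := fun q => by simp
    map_one_left := fun q => by simp }⟩, fun x t ht => ?_⟩
  change a⁻¹ * f (mk x (φ t)) = 1
  have : mk x c = mk x₀ c := by
    rcases hc with rfl | rfl
    · exact mk_zero x x₀
    · exact mk_one x x₀
  rw [ht, this]
  exact inv_mul_cancel a

theorem exists_homotopic_eq_one_on_cone₀ {G : Type v} [TopologicalSpace G] [Group G]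
    [IsTopologicalGroup G] [PathConnectedSpace G] (f : C(Suspension X, G)) :
    ∃ f' : C(Suspension X, G), f.Homotopic f' ∧ ∀ p ∈ cone₀ X, f' p = 1 := by
  obtain ⟨f', hf, h⟩ := exists_homotopic_eq_one f
    -- Truncating `2t - 1` collapses the half `t ≤ 1/2` to the pole `0`.
    ⟨fun t => projIcc 0 1 zero_le_one (2 * t - 1 : ℝ), by fun_prop⟩
    (projIcc_of_le_left zero_le_one (by norm_num)) (projIcc_of_right_le zero_le_one (by norm_num)) 0 (Or.inl rfl)
  refine ⟨f', hf, ?_⟩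
  rintro p ⟨x, t, ht, rfl⟩
  refine h x t (projIcc_of_le_left zero_le_one ?_)
  have : (t : ℝ) ≤ 1 / 2 := ht
  linarith

theorem exists_homotopic_eq_one_on_cone₁ {G : Type v} [TopologicalSpace G] [Group G]
    [IsTopologicalGroup G] [PathConnectedSpace G] (f : C(Suspension X, G)) :
    ∃ f' : C(Suspension X, G), f.Homotopic f' ∧ ∀ p ∈ cone₁ X, f' p = 1 := by
  obtain ⟨f', hf, h⟩ := exists_homotopic_eq_one f
    -- Truncating `2t` collapses the half `t ≥ 1/2` to the pole `1`.
    ⟨fun t => projIcc 0 1 zero_le_one (2 * t : ℝ), by fun_prop⟩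
    (projIcc_of_le_left zero_le_one (by norm_num)) (projIcc_of_right_le zero_le_one (by norm_num)) 1 (Or.inr rfl)
  refine ⟨f', hf, ?_⟩
  rintro p ⟨x, t, ht, rfl⟩
  refine h x t (projIcc_of_right_le zero_le_one ?_)
  have : 1 / 2 ≤ (t : ℝ) := ht
  linarith

/-- Any two maps from a suspension to a path connected topological group can be deformed so that at
each point one of them is trivial. -/
theorem exists_homotopic_disjoint_support {Y : Type w} [TopologicalSpace Y] (e : X ≃ₜ Suspension Y)
    {G : Type v} [TopologicalSpace G] [Group G] [IsTopologicalGroup G] [PathConnectedSpace G]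
    (f g : C(X, G)) :
    ∃ f' g' : C(X, G), f.Homotopic f' ∧ g.Homotopic g' ∧ ∀ x, f' x = 1 ∨ g' x = 1 := by
  have pull (f : C(X, G)) (f' : C(Suspension Y, G))
      (h : (f.comp (e.symm : C(Suspension Y, X))).Homotopic f') :
      f.Homotopic (f'.comp (e : C(X, Suspension Y))) := by
    have := h.comp (ContinuousMap.Homotopic.refl (e : C(X, Suspension Y)))
    have h' : (f.comp (e.symm : C(Suspension Y, X))).comp (e : C(X, Suspension Y)) = f := by
      ext x
      simp
    rwa [h'] at this
  obtain ⟨f', hf, hf'⟩ :=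
    exists_homotopic_eq_one_on_cone₀ (f.comp (e.symm : C(Suspension Y, X)))
  obtain ⟨g', hg, hg'⟩ :=
    exists_homotopic_eq_one_on_cone₁ (g.comp (e.symm : C(Suspension Y, X)))
  refine ⟨_, _, pull f f' hf, pull g g' hg, fun x => ?_⟩
  exact (mem_cone₀_or_mem_cone₁ (e x)).imp (hf' _) (hg' _)

end Suspension

/-! ### The group of homotopy classes -/

namespace HomotopyClasses

variable {X : Type u} [TopologicalSpace X]

theorem mk_eq_mk {Z : Type v} [TopologicalSpace Z] {f g : C(X, Z)} :
    mk f = mk g ↔ f.Homotopic g := Quotient.eq (r := homotopicSetoid X Z)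

variable {G : Type v} [TopologicalSpace G] [Group G] [IsTopologicalGroup G]

theorem mk_mul (f g : C(X, G)) : mk (f * g) = mk f * mk g := rfl

theorem mk_inv (f : C(X, G)) : mk f⁻¹ = (mk f)⁻¹ := rfl

theorem mk_one : mk (1 : C(X, G)) = 1 := rfl

/-- Representatives with one factor trivial at each point commute pointwise. -/
theorem mul_comm_of_suspension [PathConnectedSpace G] {Y : Type w} [TopologicalSpace Y]
    (e : X ≃ₜ Suspension Y) (a b : HomotopyClasses X G) : a * b = b * a := by
  obtain ⟨f⟩ := a
  obtain ⟨g⟩ := b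
  change mk f * mk g = mk g * mk f
  obtain ⟨f', g', hf, hg, h⟩ := Suspension.exists_homotopic_disjoint_support e f g
  rw [mk_eq_mk.2 hf, mk_eq_mk.2 hg, ← mk_mul, ← mk_mul]
  congr 1
  ext1 x
  rcases h x with h | h <;> simp [h]

end HomotopyClasses

/-! ### The turning obstruction on suspensions -/

section Obstruction

variable {k : ℕ} {X : Type u} [TopologicalSpace X]

theorem TO_mk (γ : PathTurning k) (g : C(X, SO (2 * k))) :
    TO γ X (HomotopyClasses.mk g) = HomotopyClasses.mk (conjMap γ g) := rfl

/-- A map on `SX` which only depends on the suspension coordinate and starts at `1` is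
null-homotopic. -/
theorem homotopic_one_of_path {Z : Type v} [TopologicalSpace Z] [One Z] (f : C(Suspension X, Z))
    (δ : C(I, Z)) (h : δ 0 = 1) (hf : ∀ x t, f (Suspension.mk x t) = δ t) : f.Homotopic 1 := by
  -- The path is shrunk to its starting point. The homotopy is free, so the value at the pole `t =
  -- 1` may move.
  refine Suspension.homotopic_of_family ⟨fun p => δ (σ p.2 * p.1.2), by fun_prop⟩
    (fun x x' s => rfl) (fun x x' s => rfl) (fun x t => ?_) (fun x t => ?_)
  · simp [hf]
  · simp [h]

theorem TO_one (γ : PathTurning k) : TO γ X 1 = 1 := by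
  rw [← HomotopyClasses.mk_one, TO_mk, ← HomotopyClasses.mk_one, HomotopyClasses.mk_eq_mk]
  exact homotopic_one_of_path _ γ.toContinuousMap γ.source (fun x t => by simp [conjMap_mk])

theorem TO_mul_of_suspension (γ : PathTurning k) {Y : Type w} [TopologicalSpace Y]
    (e : X ≃ₜ Suspension Y) (a b : HomotopyClasses X (SO (2 * k))) :
    TO γ X (a * b) = TO γ X a * TO γ X b := by
  obtain ⟨f⟩ := a
  obtain ⟨g⟩ := b
  change TO γ X (.mk f * .mk g) = TO γ X (.mk f) * TO γ X (.mk g)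
  obtain ⟨f', g', hf, hg, h⟩ := Suspension.exists_homotopic_disjoint_support e f g
  -- Dividing by `conjMap γ 1`, which is null-homotopic, keeps the class but makes the
  -- representative trivial wherever `f` is `1`. Multiplicativity then holds pointwise.
  have key (f : C(X, SO (2 * k))) :
      TO γ X (.mk f) = .mk (conjMap γ f * (conjMap γ 1)⁻¹) := by
    rw [HomotopyClasses.mk_mul, HomotopyClasses.mk_inv, ← TO_mk, ← TO_mk,
      HomotopyClasses.mk_one, TO_one, inv_one, mul_one]
  rw [HomotopyClasses.mk_eq_mk.2 hf, HomotopyClasses.mk_eq_mk.2 hg, ← HomotopyClasses.mk_mul,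
    key, key, key, ← HomotopyClasses.mk_mul]
  congr 1
  apply Suspension.ext_mk
  intro x t
  simp only [ContinuousMap.mul_apply, ContinuousMap.inv_apply, conjMap_mk,
    ContinuousMap.one_apply, one_mul, inv_one, mul_one]
  rcases h x with h | h <;> simp [h]

theorem conjMap_homotopic_of_path {γ δ : PathTurning k} (h : δ.Homotopic γ)
    (g : C(X, SO (2 * k))) : (conjMap δ g).Homotopic (conjMap γ g) := by
  obtain ⟨H⟩ := h
  refine Suspension.homotopic_of_family
    ⟨fun p => g p.1.1 * H (p.2, p.1.2) * (g p.1.1)⁻¹, by fun_prop⟩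
    (fun x x' s => by simp) (fun x x' s => by simp [negOne_central])
    (fun x t => by simp [conjMap_mk]) (fun x t => by simp [conjMap_mk])

end Obstruction

/-! ### Bundle turnings in a trivialisation -/

theorem orientation_map_trans {M N P ι : Type*} [AddCommGroup M] [Module ℝ M] [AddCommGroup N]
    [Module ℝ N] [AddCommGroup P] [Module ℝ P] (e : M ≃ₗ[ℝ] N) (f : N ≃ₗ[ℝ] P)
    (x : Orientation ℝ M ι) :
    Orientation.map ι (e.trans f) x = Orientation.map ι f (Orientation.map ι e x) := by
  induction x using Module.Ray.ind with
  | h v hv => rfl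

section Frames

section Fibre

variable {n : ℕ} {B : Type u} {E : B → Type v} [∀ b, NormedAddCommGroup (E b)]
  [∀ b, InnerProductSpace ℝ (E b)] {b : B}

theorem IsOrientedFrame.exists_SO {o : Orientation ℝ (E b) (Fin n)}
    {φ φ' : Eu n ≃ₗᵢ[ℝ] E b} (h : IsOrientedFrame o φ) (h' : IsOrientedFrame o φ') :
    ∃ A : SO n, ∀ v, φ' v = φ (A.toIsometry v) := by
  obtain ⟨A, hA⟩ := SO.exists_toIsometry_eq_of_map_stdOrientation (φ'.trans φ.symm) (by
    unfold IsOrientedFrame at h h'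
    change Orientation.map _ (φ'.toLinearEquiv.trans φ.toLinearEquiv.symm) _ = _
    rw [orientation_map_trans, h', ← h, ← Orientation.map_symm, Equiv.symm_apply_apply])
  exact ⟨A, fun v => by rw [hA]; simp⟩

theorem IsOrientedFrame.comp_toIsometry {o : Orientation ℝ (E b) (Fin n)}
    {φ : Eu n ≃ₗᵢ[ℝ] E b} (h : IsOrientedFrame o φ) (A : SO n) :
    IsOrientedFrame o (A.toIsometry.trans φ) := by
  unfold IsOrientedFrame at *
  change Orientation.map _ (A.toIsometry.toLinearEquiv.trans φ.toLinearEquiv) _ = _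
  rw [orientation_map_trans, SO.map_stdOrientation, h]

end Fibre

variable {n : ℕ} {B : Type u} [TopologicalSpace B] {E : B → Type v}
  [TopologicalSpace (TotalSpace (Eu n) E)] [∀ b, NormedAddCommGroup (E b)]
  [∀ b, InnerProductSpace ℝ (E b)]

variable [FiberBundle (Eu n) E] [VectorBundle ℝ (Eu n) E]

namespace TrivialisationOver

variable {o : BundleOrientation (n := n) E} {C : Set B}

theorem continuous_frame_apply (T : TrivialisationOver o C) {Z : Type w} [TopologicalSpace Z]
    {c : Z → C} {v : Z → Eu n} (hc : Continuous c) (hv : Continuous v) :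
    Continuous fun z => (⟨c z, T.frame (c z) (v z)⟩ : TotalSpace (Eu n) E) :=
  T.continuous_frame.comp (hc.prodMk hv)

/-- The coordinates of the inverse image are inner products with the images of the standard basis,
continuous because the metric of the bundle is. -/
theorem continuous_frame_symm_apply [IsContinuousRiemannianBundle (Eu n) E]
    (T : TrivialisationOver o C) {Z : Type w} [TopologicalSpace Z]
    {c : Z → C} {v : ∀ z, E (c z)} (hc : Continuous c)
    (hv : Continuous fun z => (⟨c z, v z⟩ : TotalSpace (Eu n) E)) :
    Continuous fun z => (T.frame (c z)).symm (v z) := by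
  refine (PiLp.continuous_toLp 2 _).comp (continuous_pi fun i => ?_)
  have h := Continuous.inner_bundle (F := Eu n) (E := E)
    (v := fun z => T.frame (c z) (EuclideanSpace.single i (1 : ℝ)))
    (T.continuous_frame_apply hc continuous_const) hv
  convert h using 2 with z
  conv_rhs => rw [← (T.frame (c z)).apply_symm_apply (v z)]
  rw [LinearIsometryEquiv.inner_map_map]
  simp [EuclideanSpace.inner_single_left]

/-- The automorphism of the fibre over `b` given by a matrix in a trivialisation. -/
noncomputable def conj (T : TrivialisationOver o C) (b : C) (A : SO n) : E b ≃ₗᵢ[ℝ] E b :=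
  ((T.frame b).symm.trans A.toIsometry).trans (T.frame b)

theorem conj_frame (T : TrivialisationOver o C) (b : C) (A : SO n) (v : Eu n) :
    T.conj b A (T.frame b v) = T.frame b (A.toIsometry v) := by
  simp [conj]

theorem continuous_conj [IsContinuousRiemannianBundle (Eu n) E] (T : TrivialisationOver o C)
    {Z : Type w} [TopologicalSpace Z] {c : Z → C} {v : ∀ z, E (c z)} {A : Z → SO n}
    (hc : Continuous c) (hv : Continuous fun z => (⟨c z, v z⟩ : TotalSpace (Eu n) E))
    (hA : Continuous A) :
    Continuous fun z => (⟨c z, T.conj (c z) (A z) (v z)⟩ : TotalSpace (Eu n) E) :=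
  T.continuous_frame_apply hc
    (SO.continuous_toIsometry_apply.comp (hA.prodMk (T.continuous_frame_symm_apply hc hv)))

end TrivialisationOver

end Frames

section GammaTurnings

variable {k : ℕ} {B : Type u} [TopologicalSpace B] {E : B → Type v}
  [TopologicalSpace (TotalSpace (Eu (2 * k)) E)] [∀ b, NormedAddCommGroup (E b)]
  [∀ b, InnerProductSpace ℝ (E b)] [FiberBundle (Eu (2 * k)) E] [VectorBundle ℝ (Eu (2 * k)) E]
  {o : BundleOrientation (n := 2 * k) E} {γ : PathTurning k}

/-- The conjugate of a turning by an element of `SO_{2k}`. -/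
def conjPath (δ : PathTurning k) (h : SO (2 * k)) : PathTurning k where
  toFun t := h * δ t * h⁻¹
  continuous_toFun := by fun_prop
  source' := by simp
  target' := by simp [negOne_central]

theorem conjPath_homotopic {δ : PathTurning k} (hδ : δ.Homotopic γ) (h : SO (2 * k)) :
    (conjPath δ h).Homotopic (conjPath γ h) := by
  obtain ⟨H⟩ := hδ
  refine ⟨{ toFun := fun p => h * H p * h⁻¹
            continuous_toFun := by fun_prop
            map_zero_left := fun t => by simp [conjPath]
            map_one_left := fun t => by simp [conjPath]
            prop' := ?_ }⟩
  rintro s t (rfl | rfl)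
  · simp [conjPath]
  · simp [conjPath]

/-- In a trivialisation, a `γ`-turning is a continuous family of turnings, each conjugate to a
turning path homotopic to `γ`. -/
theorem BundleTurning.IsGammaTurning.exists_matrix [IsContinuousRiemannianBundle (Eu (2 * k)) E]
    {ψ : BundleTurning (2 * k) E} (hψ : ψ.IsGammaTurning o γ) {C : Set B}
    (T : TrivialisationOver o C) :
    ∃ A : C × I → SO (2 * k), Continuous A ∧
      (∀ (b : C) t v, ψ.aut t b (T.frame b v) = T.frame b ((A (b, t)).toIsometry v)) ∧
      ∀ b, ∃ (h : SO (2 * k)) (δ : PathTurning k), δ.Homotopic γ ∧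
        ∀ t, A (b, t) = conjPath δ h t := by
  have key (b : C) : ∃ (h : SO (2 * k)) (δ : PathTurning k), δ.Homotopic γ ∧
      ∀ t v, ψ.aut t b (T.frame b v) = T.frame b ((conjPath δ h t).toIsometry v) := by
    obtain ⟨φ, hφ, δ, hδ, h⟩ := hψ b
    obtain ⟨A, hA⟩ := (T.oriented b).exists_SO hφ
    refine ⟨A, δ, hδ, fun t v => ?_⟩
    have hv : T.frame b v = φ ((A⁻¹).toIsometry v) := by
      rw [hA, SO.toIsometry_inv_apply]
    rw [hv, h, hA]
    change _ = T.frame b ((A * δ t * A⁻¹).toIsometry v)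
    rw [SO.toIsometry_mul, SO.toIsometry_mul]
    rfl
  choose h δ hδ hA using key
  refine ⟨fun p => conjPath (δ p.1) (h p.1) p.2, ?_, hA, fun b => ⟨h b, δ b, hδ b, fun t => rfl⟩⟩
  -- The choices `h` and `δ` need not vary continuously with the point. Their combination does,
  -- since its entries are the inner products `⟨T eᵢ, ψ T eⱼ⟩`.
  refine SO.continuous_of_apply fun i j => ?_
  have hs (j : Fin (2 * k)) : Continuous fun p : C × I =>
      (⟨p.1, T.frame p.1 (EuclideanSpace.single j (1 : ℝ))⟩ : TotalSpace (Eu (2 * k)) E) :=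
    T.continuous_frame_apply continuous_fst continuous_const
  have h1 : Continuous fun p : C × I =>
      (⟨p.1, ψ.aut p.2 p.1 (T.frame p.1 (EuclideanSpace.single j (1 : ℝ)))⟩ :
        TotalSpace (Eu (2 * k)) E) :=
    ψ.continuous_aut.comp (continuous_snd.prodMk (hs j))
  have h2 := Continuous.inner_bundle (hs i) h1
  simpa only [hA, LinearIsometryEquiv.inner_map_map, SO.inner_single_toIsometry_single] using h2

end GammaTurnings

/-! ### Turnability in terms of the clutching function. -/

section Clutching

open Suspension

variable {k : ℕ} {X : Type u} [TopologicalSpace X] {E : Suspension X → Type v}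
  [TopologicalSpace (TotalSpace (Eu (2 * k)) E)] [∀ b, NormedAddCommGroup (E b)]
  [∀ b, InnerProductSpace ℝ (E b)] [FiberBundle (Eu (2 * k)) E] [VectorBundle ℝ (Eu (2 * k)) E]
  {o : BundleOrientation (n := 2 * k) E} {γ : PathTurning k}

/-- The point `[x, t/2]` of the cone `C₀X`. -/
noncomputable def toCone₀ : C(X × I, cone₀ X) where
  toFun p := ⟨mk p.1 (half * p.2), p.1, half * p.2, mul_le_left, rfl⟩
  continuous_toFun := by fun_prop

/-- The point `[x, 1 - t/2]` of the cone `C₁X`. -/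
noncomputable def toCone₁ : C(X × I, cone₁ X) where
  toFun p := ⟨mk p.1 (σ (half * p.2)), p.1, σ (half * p.2), by
    have h : ((half * p.2 : I) : ℝ) ≤ 1 / 2 := mul_le_left (x := half) (y := p.2)
    change (1 / 2 : ℝ) ≤ 1 - ((half * p.2 : I) : ℝ)
    linarith, rfl⟩
  continuous_toFun := by fun_prop

theorem toCone₀_one (x : X) : toCone₀ (x, 1) = ⟨equator x, equator_mem_cone₀ x⟩ :=
  Subtype.ext (by simp [toCone₀, equator])

theorem toCone₁_one (x : X) : toCone₁ (x, 1) = ⟨equator x, equator_mem_cone₁ x⟩ := by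
  have : σ half = half := Subtype.ext (by norm_num [half])
  exact Subtype.ext (by simp [toCone₁, equator, this])

theorem toCone₀_zero (x x' : X) : toCone₀ (x, 0) = toCone₀ (x', 0) :=
  Subtype.ext (by simp [toCone₀, mk_zero x x'])

theorem toCone₁_zero (x x' : X) : toCone₁ (x, 0) = toCone₁ (x', 0) :=
  Subtype.ext (by simp [toCone₁, mk_one x x'])

theorem conjMap_homotopic_one_of_gammaTurnable [IsContinuousRiemannianBundle (Eu (2 * k)) E]
    {g : C(X, SO (2 * k))} (hg : IsClutchingFunction o g) (hE : GammaTurnable o γ) :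
    (conjMap γ g).Homotopic 1 := by
  rcases isEmpty_or_nonempty X with hX | ⟨⟨x₀⟩⟩
  · rw [show conjMap γ g = 1 from ext_mk fun x _ => hX.elim x]
  obtain ⟨φ₀, φ₁, hφ⟩ := hg
  obtain ⟨ψ, hψ⟩ := hE
  obtain ⟨A₀, hA₀, hA₀ψ, hA₀γ⟩ := hψ.exists_matrix φ₀
  obtain ⟨A₁, hA₁, hA₁ψ, hA₁γ⟩ := hψ.exists_matrix φ₁
  have hA₀0 (b) : A₀ (b, 0) = 1 := by
    obtain ⟨h, δ, -, hδ⟩ := hA₀γ b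
    simp [hδ]
  have hA₀1 (b) : A₀ (b, 1) = negOne k := by
    obtain ⟨h, δ, -, hδ⟩ := hA₀γ b
    simp [hδ]
  have hA₁0 (b) : A₁ (b, 0) = 1 := by
    obtain ⟨h, δ, -, hδ⟩ := hA₁γ b
    simp [hδ]
  have hA₁1 (b) : A₁ (b, 1) = negOne k := by
    obtain ⟨h, δ, -, hδ⟩ := hA₁γ b
    simp [hδ]
  have hA (x : X) (t : I) :
      A₀ (toCone₀ (x, 1), t) = g x * A₁ (toCone₁ (x, 1), t) * (g x)⁻¹ := by
    rw [toCone₀_one, toCone₁_one]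
    rw [eq_mul_inv_iff_mul_eq]
    apply SO.toIsometry_injective
    intro v
    have hφ' (v) : φ₁.frame ⟨equator x, equator_mem_cone₁ x⟩ v =
        φ₀.frame ⟨equator x, equator_mem_cone₀ x⟩ ((g x).toIsometry v) := by
      rw [SO.toIsometry_apply, ← hφ, LinearIsometryEquiv.apply_symm_apply]
    have e₁ := hA₁ψ ⟨equator x, equator_mem_cone₁ x⟩ t v
    rw [hφ', hφ', hA₀ψ ⟨equator x, equator_mem_cone₀ x⟩] at e₁
    rw [SO.toIsometry_mul, SO.toIsometry_mul]
    exact (φ₀.frame _).injective e₁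
  -- At the tip of `C₁X` the turning is `h δ h⁻¹`; a path from `1` to `h` deforms `g` to `g h`.
  obtain ⟨h, δ, hδγ, hδ⟩ := hA₁γ (toCone₁ (x₀, 0))
  obtain ⟨p⟩ := PathConnectedSpace.joined (1 : SO (2 * k)) h
  let g' : C(X, SO (2 * k)) := ⟨fun x => g x * h, by fun_prop⟩
  have hgg' : g.Homotopic g' := ⟨{
    toFun := fun q => g q.2 * p q.1
    continuous_toFun := by fun_prop
    map_zero_left := fun x => by simp
    map_one_left := fun x => by simp [g'] }⟩
  let m : C(Suspension X, SO (2 * k)) := lift ⟨fun q => A₀ (toCone₀ (q.1, 1), q.2), by fun_prop⟩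
    (fun x x' => by simp [hA₀0]) (fun x x' => by simp [hA₀1])
  let m' : C(Suspension X, SO (2 * k)) := lift ⟨fun q => A₀ (toCone₀ (q.1, 0), q.2), by fun_prop⟩
    (fun x x' => by simp [hA₀0]) (fun x x' => by simp [hA₀1])
  -- The point of `C₁X` moves from the tip to the equator, where conjugation by `g` turns `A₁` into
  -- `A₀`.
  have h₁ : (conjMap δ g').Homotopic m := by
    refine homotopic_of_family
      ⟨fun q => g q.1.1 * A₁ (toCone₁ (q.1.1, q.2), q.1.2) * (g q.1.1)⁻¹, by fun_prop⟩
      (fun x x' s => by simp [hA₁0]) (fun x x' s => by simp [hA₁1, negOne_central])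
      (fun x t => ?_) (fun x t => (hA x t).symm)
    simp only [ContinuousMap.coe_mk, toCone₁_zero x x₀, hδ, conjMap_mk, g']
    simp [conjPath, mul_assoc]
  -- The point of `C₀X` moves from the equator to the tip, where the dependence on `x` disappears.
  have h₂ : m.Homotopic m' :=
    homotopic_of_family ⟨fun q => A₀ (toCone₀ (q.1.1, σ q.2), q.1.2), by fun_prop⟩
      (fun x x' s => by simp [hA₀0]) (fun x x' s => by simp [hA₀1])
      (fun x t => by simp [m, lift_mk]) (fun x t => by simp [m', lift_mk])
  have h₃ : m'.Homotopic 1 :=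
    homotopic_one_of_path m' ⟨fun t => A₀ (toCone₀ (x₀, 0), t), by fun_prop⟩ (hA₀0 _)
      (fun x t => by simp [m', lift_mk, toCone₀_zero x x₀])
  exact (conjMap_homotopic γ hgg').trans
    ((conjMap_homotopic_of_path hδγ g').symm.trans (h₁.trans (h₂.trans h₃)))

/-- Turnings over the two cones which agree over the equator define a turning of the bundle. -/
theorem exists_bundleTurning_of_cones [IsContinuousRiemannianBundle (Eu (2 * k)) E]
    (T₀ : TrivialisationOver o (cone₀ X)) (T₁ : TrivialisationOver o (cone₁ X))
    (A₀ A₁ : C(Suspension X × I, SO (2 * k)))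
    (h₀0 : ∀ b, A₀ (b, 0) = 1) (h₀1 : ∀ b, A₀ (b, 1) = negOne k)
    (h₁0 : ∀ b, A₁ (b, 0) = 1) (h₁1 : ∀ b, A₁ (b, 1) = negOne k)
    (h : ∀ x t v, T₀.conj ⟨equator x, equator_mem_cone₀ x⟩ (A₀ (equator x, t)) v =
      T₁.conj ⟨equator x, equator_mem_cone₁ x⟩ (A₁ (equator x, t)) v) :
    ∃ ψ : BundleTurning (2 * k) E,
      (∀ t (b : cone₀ X), ψ.aut t b = T₀.conj b (A₀ (b, t))) ∧
      ∀ t (b : cone₁ X), ψ.aut t b = T₁.conj b (A₁ (b, t)) := by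
  classical
  let a (t : I) (b : Suspension X) : E b ≃ₗᵢ[ℝ] E b :=
    if hb : b ∈ cone₀ X then T₀.conj ⟨b, hb⟩ (A₀ (b, t))
    else T₁.conj ⟨b, (mem_cone₀_or_mem_cone₁ b).resolve_left hb⟩ (A₁ (b, t))
  have ha₀ (t : I) (b : cone₀ X) : a t b = T₀.conj b (A₀ (b, t)) := by
    simp only [a, dif_pos b.2]
  have ha₁ (t : I) (b : cone₁ X) : a t b = T₁.conj b (A₁ (b, t)) := by
    obtain ⟨b, hb⟩ := b
    by_cases hb' : b ∈ cone₀ X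
    · obtain ⟨x, rfl⟩ := exists_eq_equator hb' hb
      ext1 v
      rw [ha₀ t ⟨_, hb'⟩]
      exact h x t v
    · simp only [a, dif_neg hb']
  have hconj_one {C : Set (Suspension X)} (T : TrivialisationOver o C) (b : C) (v : E b) :
      T.conj b 1 v = v := by
    simp [TrivialisationOver.conj, SO.toIsometry_one]
  have hconj_negOne {C : Set (Suspension X)} (T : TrivialisationOver o C) (b : C) (v : E b) :
      T.conj b (negOne k) v = -v := by
    simp [TrivialisationOver.conj, SO.toIsometry_negOne]
  refine ⟨⟨a, ?_, fun b v => ?_, fun b v => ?_⟩, ha₀, ha₁⟩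
  · let D₀ : Set (I × TotalSpace (Eu (2 * k)) E) := {p | p.2.1 ∈ cone₀ X}
    let D₁ : Set (I × TotalSpace (Eu (2 * k)) E) := {p | p.2.1 ∈ cone₁ X}
    have hproj : Continuous fun p : I × TotalSpace (Eu (2 * k)) E => p.2.1 :=
      (FiberBundle.continuous_proj (Eu (2 * k)) E).comp continuous_snd
    have hD₀ : IsClosed D₀ := isClosed_cone₀.preimage hproj
    have hD₁ : IsClosed D₁ := isClosed_cone₁.preimage hproj
    have hD : D₀ ∪ D₁ = univ := eq_univ_of_forall fun p => mem_cone₀_or_mem_cone₁ p.2.1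
    rw [← continuousOn_univ, ← hD]
    -- Pasting over the preimages of the two closed cones.
    refine ContinuousOn.union_of_isClosed ?_ ?_ hD₀ hD₁
    · rw [continuousOn_iff_continuous_domRestrict]
      have := T₀.continuous_conj (Z := D₀) (c := fun p => ⟨p.1.2.1, p.2⟩) (v := fun p => p.1.2.2)
        (A := fun p => A₀ (p.1.2.1, p.1.1))
        ((hproj.comp continuous_subtype_val).subtype_mk _)
        (continuous_snd.comp continuous_subtype_val)
        (A₀.continuous.comp ((hproj.comp continuous_subtype_val).prodMk
          (continuous_fst.comp continuous_subtype_val)))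
      convert this using 2 with p
      exact congrArg (TotalSpace.mk p.1.2.1) (congrArg (fun f => f p.1.2.2) (ha₀ p.1.1 ⟨_, p.2⟩))
    · rw [continuousOn_iff_continuous_domRestrict]
      have := T₁.continuous_conj (Z := D₁) (c := fun p => ⟨p.1.2.1, p.2⟩) (v := fun p => p.1.2.2)
        (A := fun p => A₁ (p.1.2.1, p.1.1))
        ((hproj.comp continuous_subtype_val).subtype_mk _)
        (continuous_snd.comp continuous_subtype_val)
        (A₁.continuous.comp ((hproj.comp continuous_subtype_val).prodMk
          (continuous_fst.comp continuous_subtype_val)))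
      convert this using 2 with p
      exact congrArg (TotalSpace.mk p.1.2.1) (congrArg (fun f => f p.1.2.2) (ha₁ p.1.1 ⟨_, p.2⟩))
  · rcases mem_cone₀_or_mem_cone₁ b with hb | hb
    · rw [ha₀ 0 ⟨b, hb⟩, h₀0, hconj_one]
    · rw [ha₁ 0 ⟨b, hb⟩, h₁0, hconj_one]
  · rcases mem_cone₀_or_mem_cone₁ b with hb | hb
    · rw [ha₀ 1 ⟨b, hb⟩, h₀1, hconj_negOne]
    · rw [ha₁ 1 ⟨b, hb⟩, h₁1, hconj_negOne]

/-- A null-homotopy of `[x, t] ↦ g(x) γ(t) g(x)⁻¹` can be made to consist of paths from `1`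
to `-1`. -/
theorem exists_rel_nullhomotopy {g : C(X, SO (2 * k))} (h : (conjMap γ g).Homotopic 1) :
    ∃ R : C((I × X) × I, SO (2 * k)), (∀ x t, R ((0, x), t) = g x * γ t * (g x)⁻¹) ∧
      (∀ x x' t, R ((1, x), t) = R ((1, x'), t)) ∧ (∀ u x, R ((u, x), 0) = 1) ∧
      ∀ u x, R ((u, x), 1) = negOne k := by
  obtain ⟨H⟩ := h
  -- Left division by `H (u, [x, 0])` makes each stage start at `1`; the factor `c x (u * t)` then
  -- corrects the end to `-1`. It is trivial at `u = 0`, and at `u = 1`, where `H` is constant, it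
  -- is all that remains and depends only on the poles.
  let c (x : X) (u : I) : SO (2 * k) := (H (u, mk x 1))⁻¹ * H (u, mk x 0) * negOne k
  have hc : Continuous fun p : X × I => c p.1 p.2 := by fun_prop
  have hc0 (x : X) : c x 0 = 1 := by simp [c, conjMap_mk, negOne_central]
  refine ⟨⟨fun p => (H (p.1.1, mk p.1.2 0))⁻¹ * H (p.1.1, mk p.1.2 p.2) *
    c p.1.2 (p.1.1 * p.2), by fun_prop⟩, fun x t => ?_, fun x x' t => ?_, fun u x => ?_,
    fun u x => ?_⟩
  · simp [hc0, conjMap_mk]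
  · simp [c, mk_zero x x', mk_one x x']
  · simp [hc0]
  · simp [c, mul_assoc]

theorem gammaTurnable_of_conjMap_homotopic_one [IsContinuousRiemannianBundle (Eu (2 * k)) E]
    {g : C(X, SO (2 * k))} (hg : IsClutchingFunction o g) (h : (conjMap γ g).Homotopic 1) :
    GammaTurnable o γ := by
  obtain ⟨φ₀, φ₁, hφ⟩ := hg
  obtain ⟨R, hR0, hR1, hRs, hRt⟩ := exists_rel_nullhomotopy h
  -- The homotopy parameter is `0` at the equator and `1` at both poles, so the family descends to
  -- all of `SX`; only its values over `C₀X` enter the turning.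
  let θ : C(I, I) := ⟨fun r => ⟨|1 - 2 * r|, abs_nonneg _, by
    obtain ⟨r, h0, h1⟩ := r
    exact abs_le.2 ⟨by dsimp only; linarith, by dsimp only; linarith⟩⟩, by fun_prop⟩
  have hθ0 : θ 0 = 1 := Subtype.ext (by simp [θ])
  have hθ1 : θ 1 = 1 := Subtype.ext (by norm_num [θ])
  have hθ : θ half = 0 := Subtype.ext (by norm_num [θ, half])
  let P : C(Suspension X, C(I, SO (2 * k))) := lift
    (ContinuousMap.curry ⟨fun p : (X × I) × I => R ((θ p.1.2, p.1.1), p.2), by fun_prop⟩)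
    (fun x x' => by ext1 t; simp [hθ0, hR1 x x']) (fun x x' => by ext1 t; simp [hθ1, hR1 x x'])
  let A₀ : C(Suspension X × I, SO (2 * k)) := P.uncurry
  have hA₀ (x : X) (r t : I) : A₀ (mk x r, t) = R ((θ r, x), t) := rfl
  let A₁ : C(Suspension X × I, SO (2 * k)) := ⟨fun p => γ p.2, by fun_prop⟩
  have hφ' (x : X) (v) : φ₁.frame ⟨equator x, equator_mem_cone₁ x⟩ v =
      φ₀.frame ⟨equator x, equator_mem_cone₀ x⟩ ((g x).toIsometry v) := by
    rw [SO.toIsometry_apply, ← hφ, LinearIsometryEquiv.apply_symm_apply]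
  obtain ⟨ψ, hψ₀, hψ₁⟩ := exists_bundleTurning_of_cones φ₀ φ₁ A₀ A₁
    (fun b => by
      obtain ⟨x, r, rfl⟩ := mk_surjective b
      rw [hA₀, hRs])
    (fun b => by
      obtain ⟨x, r, rfl⟩ := mk_surjective b
      rw [hA₀, hRt])
    (fun b => by simp [A₁]) (fun b => by simp [A₁])
    (fun x t v => by
      obtain ⟨w, rfl⟩ := (φ₁.frame ⟨equator x, equator_mem_cone₁ x⟩).surjective v
      rw [TrivialisationOver.conj_frame, hφ', hφ', TrivialisationOver.conj_frame,
        show A₀ (equator x, t) = _ from hA₀ x half t, hθ, hR0, ← SO.toIsometry_mul, ← SO.toIsometry_mul, inv_mul_cancel_right]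
      rfl)
  refine ⟨ψ, fun b => ?_⟩
  rcases mem_cone₀_or_mem_cone₁ b with hb | hb
  · obtain ⟨x, r, rfl⟩ := mk_surjective b
    let b : cone₀ X := ⟨mk x r, hb⟩
    let δ : PathTurning k :=
      { toFun := fun t => R ((θ r, x), t)
        continuous_toFun := by fun_prop
        source' := hRs _ _
        target' := hRt _ _ }
    -- Running the null-homotopy back to stage `0` gives `g(x) γ g(x)⁻¹`, with end points fixed.
    have hδ : δ.Homotopic (conjPath γ (g x)) := by
      refine ⟨{ toFun := fun p => R ((σ p.1 * θ r, x), p.2)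
                continuous_toFun := by fun_prop
                map_zero_left := fun t => by simp [δ]
                map_one_left := fun t => by simp [hR0, conjPath]
                prop' := ?_ }⟩
      rintro s t (rfl | rfl)
      · simp [hRs]
      · simp [hRt]
    have hδ' := conjPath_homotopic hδ (g x)⁻¹
    have hγ : conjPath (conjPath γ (g x)) (g x)⁻¹ = γ := by
      ext t : 2
      simp [conjPath, mul_assoc]
    rw [hγ] at hδ'
    -- Twisting the frame by `g(x)` undoes this conjugation.
    refine ⟨(g x).toIsometry.trans (φ₀.frame b), (φ₀.oriented b).comp_toIsometry _, _, hδ',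
      fun t v => ?_⟩
    have e := hψ₀ t b
    change ψ.aut t (mk x r) = _ at e
    rw [e]
    change φ₀.conj b (A₀ (mk x r, t)) (φ₀.frame b ((g x).toIsometry v)) =
      φ₀.frame b ((g x).toIsometry (SO.toIsometry _ v))
    rw [TrivialisationOver.conj_frame, ← SO.toIsometry_mul, ← SO.toIsometry_mul]
    congr 2
    simp [conjPath, mul_assoc, hA₀, δ]
  · refine ⟨φ₁.frame ⟨b, hb⟩, φ₁.oriented _, γ, .refl γ, fun t v => ?_⟩
    rw [hψ₁ t ⟨b, hb⟩, TrivialisationOver.conj_frame]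
    rfl

theorem gammaTurnable_iff [IsContinuousRiemannianBundle (Eu (2 * k)) E]
    {g : C(X, SO (2 * k))} (hg : IsClutchingFunction o g) :
    GammaTurnable o γ ↔ TO γ X (HomotopyClasses.mk g) = 1 := by
  rw [TO_mk, ← HomotopyClasses.mk_one, HomotopyClasses.mk_eq_mk]
  exact ⟨conjMap_homotopic_one_of_gammaTurnable hg, gammaTurnable_of_conjMap_homotopic_one hg⟩

end Clutching

end Turning

theorem propositionp {k : ℕ} (γ : Turning.PathTurning k)
    {X : Type*} [TopologicalSpace X] :
    (∀ (E : Turning.Suspension X → Type*)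
      [TopologicalSpace (TotalSpace (Turning.Eu (2 * k)) E)]
      [∀ b, NormedAddCommGroup (E b)] [∀ b, InnerProductSpace ℝ (E b)]
      [FiberBundle (Turning.Eu (2 * k)) E] [VectorBundle ℝ (Turning.Eu (2 * k)) E]
      [IsContinuousRiemannianBundle (Turning.Eu (2 * k)) E]
      (o : Turning.BundleOrientation (n := 2 * k) E) (g : C(X, Turning.SO (2 * k))),
      Turning.IsClutchingFunction o g →
        (Turning.GammaTurnable o γ ↔ Turning.TO γ X (Turning.HomotopyClasses.mk g) = 1)) ∧
    (∀ (Y : Type*) [TopologicalSpace Y], Nonempty (X ≃ₜ Turning.Suspension Y) →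
      (∀ a b : Turning.HomotopyClasses X (Turning.SO (2 * k)), a * b = b * a) ∧
      (∀ a b : Turning.HomotopyClasses (Turning.Suspension X) (Turning.SO (2 * k)),
        a * b = b * a) ∧
      (∀ a b : Turning.HomotopyClasses X (Turning.SO (2 * k)),
        Turning.TO γ X (a * b) = Turning.TO γ X a * Turning.TO γ X b)) := by
  refine ⟨?_, ?_⟩
  · intro E _ _ _ _ _ _ o g hg
    exact Turning.gammaTurnable_iff hg
  · rintro Y _ ⟨e⟩
    exact ⟨Turning.HomotopyClasses.mul_comm_of_suspension e,
      Turning.HomotopyClasses.mul_comm_of_suspension (Homeomorph.refl _),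
      Turning.TO_mul_of_suspension γ e⟩
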